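/- **Setting.** Time $t\in\mathbb{N}$ is discrete, with sampling interval $\Delta t>0$. A leader ($0$) drives at constant speed $v_0$, so its output $k$ steps after time $t$ is $\boldsymbol y_0(k|t)=[s_0(0)+(t+k)v_0\Delta t,\;v_0]^\top$. The platoon starts with $N$ followers; $N_{ci}$ further vehicles cut in at times $t_{ci,i}$ (at any positions) and $N_{co}$ vehicles cut out at times $t_{co,j}$; each vehicle enters at most once and leaves at most once, not before it has entered. The followers present at time $t$ are indexed $1,2,\dots$ from front to back. Follower $i$ has state $\boldsymbol x_i=[s_i,v_i,T_i]^\top$, output $\boldsymbol y_i=[s_i,v_i]^\top$ and dynamics $\boldsymbol x_i(t+1)=\boldsymbol\phi_i(\boldsymbol x_i(t))+u_i(t)\boldsymbol\psi_i$, where $\boldsymbol\psi_i=[0,0,\Delta t/\tau_i]^\top$ and $$\boldsymbol\phi_i(\boldsymbol x)=\Big[s+v\Delta t,\; v+\tfrac{\Delta t}{m_i}\big(\tfrac{\eta_i}{r_i}T-\Gamma_i(v)\big),\; T-\tfrac{1}{\tau_i}T\Delta t\Big]^\top,\qquad \Gamma_i(v)=C_{A,i}v^2+m_igf_i,$$ with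 $m_i,\tau_i,r_i,\eta_i>0$. Put $h_i(v)=\frac{r_i}{\eta_i}\Gamma_i(v)$, $\boldsymbol y_{\mathrm{des},i}(k|t)=\boldsymbol y_0(k|t)-[i\,d_0,0]^\top$ and $\widetilde{\boldsymbol d}_{i,j}=[(j-i)d_0,0]^\top$. Communication at time $t$ is unidirectional (front to back): $\mathbb N_i$ is the set of followers, all ahead of $i$, that send information to $i$, $\mathbb O_i$ the set of those that receive it from $i$, $p_i\in\{0,1\}$ says whether $i$ hears the leader, and $\mathbb I_i=\mathbb N_i\cup\{0\}$ if $p_i=1$, $\mathbb I_i=\mathbb N_i$ if $p_i=0$. *Assumption 1:* at every time the communication graph on the leader and the present followers contains a spanning tree rooted at the leader. **Problem (1) (DNMPC)** of a present follower $i$ at time $t$, with horizon $N_p\ge1$, weights $\boldsymbol Q_i,\boldsymbol F_i,\boldsymbol G_i\in\mathbb{R}^{2\times2}$, $R_i\in\mathbb{R}$, and current state $\boldsymbol x_i(t)$: minimise over $\mathcal U_i=(u_i(0|t),\dots,u_i(N_p-1|t))$ the cost $$J_i=\sum_{k=0}^{N_p-1}\Big(\|\boldsymbol y_i^p-\boldsymbol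 y_{\mathrm{des},i}\|_{\boldsymbol Q_i}+\|u_i-h_i(v_i^p)\|_{R_i}+\|\boldsymbol y_i^p-\boldsymbol y_i^a\|_{\boldsymbol F_i}+\sum_{j\in\mathbb N_i}\|\boldsymbol y_i^p-\boldsymbol y_j^a-\widetilde{\boldsymbol d}_{i,j}\|_{\boldsymbol G_i}\Big)(k|t),\qquad \|\boldsymbol x\|_{\boldsymbol A}:=\boldsymbol x^\top\boldsymbol A\boldsymbol x,$$ where $\boldsymbol x_i^p(\cdot|t)$, $\boldsymbol y_i^p(\cdot|t)$ are the states and outputs predicted from $\boldsymbol x_i(t)$ with the inputs $\mathcal U_i$, subject to $u_i(k|t)\in[u_{\min,i},u_{\max,i}]$, $\;\boldsymbol y_i^p(N_p|t)=\frac1{|\mathbb I_i|}\sum_{j\in\mathbb I_i}\big(\boldsymbol y_j^a(N_p|t)+\widetilde{\boldsymbol d}_{i,j}\big)$ and $T_i^p(N_p|t)=h_i(v_i^p(N_p|t))$. For the leader $\boldsymbol y_0^a=\boldsymbol y_0$. **Receding-horizon loop.** At each time $t$ every present follower computes some $\mathcal U_i(t)$ and applies its first entry. If it is still present at time $t+1$,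 its assumed output $\boldsymbol y_i^a(k|t+1)$, $0\le k\le N_p$, is the output predicted from $\boldsymbol x_i^p(1|t)$ with the inputs $u_i(1|t),\dots,u_i(N_p-1|t),h_i(v_i^p(N_p|t))$. When a vehicle joins, its state and its assumed outputs are arbitrary. A *DNMPC solution* is a run of this loop in which every $\mathcal U_i(t)$ solves Problem (1) for some weights $\boldsymbol Q_i,\boldsymbol F_i,\boldsymbol G_i\succeq0$, $R_i\ge0$ (which may depend on $t$). **Problem (7) (metric learning).** Let $\varepsilon>0$, and write $\boldsymbol A\succeq_\varepsilon0$ if $\boldsymbol A$ is symmetric with all eigenvalues at least $\varepsilon$. Minimise $J_i$ jointly over $\mathcal U_i,\boldsymbol Q_i,\boldsymbol\Theta_i,R_i,\boldsymbol F_i,\boldsymbol G_i$ subject to the constraints of Problem (1) and: $\boldsymbol\Theta_i\succeq_\varepsilon0$; $\boldsymbol Q_i=\boldsymbol\Theta_i$ if $p_i=1$ and $\boldsymbol Q_i=0$ if $p_i=0$; $R_i\ge\varepsilon$; $\boldsymbol G_i\succeq_\varepsilon0$ if $\mathbb N_i\ne\varnothing$ and $\boldsymbol G_i=0$ otherwise;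 $\boldsymbol F_i\succeq_\varepsilon0$ if $\mathbb O_i=\varnothing$ and $\boldsymbol F_i-\sum_{j\in\mathbb O_i}\boldsymbol G_j\succeq0$ otherwise. **ADMM.** Let $\rho>0$. From arbitrary initial values at time $t$, iterate over $\kappa=0,1,2,\dots$, simultaneously for all present followers and in this order: - $\mathcal U_i^{(\kappa+1)}$ is a solution of Problem (1) with the weights of iteration $\kappa$; - $\boldsymbol Q_i^{(\kappa+1)}=0$ if $p_i=0$, otherwise a minimiser over $\mathbb{R}^{2\times 2}$ of $J_i+\frac\rho2\|\boldsymbol Q_i-\boldsymbol\Theta_i^{(\kappa)}+\boldsymbol\Omega_i^{(\kappa)}\|_F^2$; - $\boldsymbol\Theta_i^{(\kappa+1)}$ minimises $\frac\rho2\|\boldsymbol Q_i^{(\kappa+1)}-\boldsymbol\Theta_i+\boldsymbol\Omega_i^{(\kappa)}\|_F^2$ over $\boldsymbol\Theta_i\succeq_\varepsilon0$; - $\boldsymbol\Omega_i^{(\kappa+1)}=\boldsymbol\Omega_i^{(\kappa)}+\boldsymbol Q_i^{(\kappa+1)}-\boldsymbol\Theta_i^{(\kappa+1)}$; - $R_i^{(\kappa+1)}$,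 then $\boldsymbol G_i^{(\kappa+1)}$, then $\boldsymbol F_i^{(\kappa+1)}$ minimise $J_i$ in the respective variable under its constraint in Problem (7). **Theorem.** Let Assumption 1 hold. Consider a run of the receding-horizon loop in which, at each time $t$, the sequences $\mathcal U_i(t)$ are obtained from Problem (7) by ADMM, that is, for each present $i$, $\mathcal U_i(t)$ is an iterate $\mathcal U_i^{(\kappa)}$ with $\kappa\ge1$ or a limit point of $(\mathcal U_i^{(\kappa)})_\kappa$ for an ADMM run at time $t$ (or, alternatively, the $\mathcal U_i(t)$ belong to an exact solution of Problem (7) for all present followers). Put $$t_{\mathrm{conv}}:=\max_{i,j}\{t_{ci,i},\,t_{co,j}\}+N+N_{ci}-N_{co}$$ (the maximum being $0$ if there is no maneuver). Then for all $t\ge t_{\mathrm{conv}}$ and all followers $i$ present at time $t$: 1. $\boldsymbol y_i^p(N_p|t)=\boldsymbol y_{\mathrm{des},i}(N_p|t)$; 2. $\boldsymbol y_i^p(N_p|t)$ coincides with the terminal predicted output at time $t$ of every DNMPC solution for the same platoon (same vehicles, maneuvers, communication and leader), whatever its weights, initial states and initial assumed outputs. -/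

import Mathlib

namespace Platoon

open scoped Matrix

noncomputable section

/-- Outputs `(position, velocity)`. -/
abbrev Output := Fin 2 → ℝ

/-- States `(position, velocity, torque)`. -/
abbrev State := Fin 3 → ℝ

abbrev Mat2 := Matrix (Fin 2) (Fin 2) ℝ

/-- Data common to the whole platoon: sampling interval, gravity constant, desired gap, constant
speed and initial position of the leader, predictive horizon, and the constants `ε`, `ρ` of
metric learning and ADMM. -/
structure Params where
  dt : ℝ
  grav : ℝ
  gap : ℝ
  v0 : ℝ
  s0 : ℝ
  Np : ℕ
  eps : ℝ
  rho : ℝ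
  dt_pos : 0 < dt
  Np_pos : 0 < Np
  eps_pos : 0 < eps
  rho_pos : 0 < rho

/-- Physical data of one follower: mass, aerodynamic drag, rolling resistance, inertial lag, tire
radius, driveline efficiency, and bounds of the control input. -/
structure VehicleParams where
  m : ℝ
  CA : ℝ
  f : ℝ
  tau : ℝ
  r : ℝ
  eta : ℝ
  umin : ℝ
  umax : ℝ
  m_pos : 0 < m
  tau_pos : 0 < tau
  r_pos : 0 < r
  eta_pos : 0 < eta

/-- The resistance `Γ(v) = C_A v² + m g f`. -/
def VehicleParams.resist (c : VehicleParams) (P : Params) (v : ℝ) : ℝ :=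
  c.CA * v ^ 2 + c.m * P.grav * c.f

/-- The external drag (equilibrium torque) `h(v) = (r / η) (C_A v² + m g f)`. -/
def VehicleParams.drag (c : VehicleParams) (P : Params) (v : ℝ) : ℝ :=
  c.r / c.eta * c.resist P v

def VehicleParams.phi (c : VehicleParams) (P : Params) (x : State) : State :=
  ![x 0 + x 1 * P.dt,
    x 1 + P.dt / c.m * (c.eta / c.r * x 2 - c.resist P (x 1)),
    x 2 - 1 / c.tau * x 2 * P.dt]

def VehicleParams.psi (c : VehicleParams) (P : Params) : State :=
  ![0, 0, 1 / c.tau * P.dt]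

def gam : Matrix (Fin 2) (Fin 3) ℝ := !![1, 0, 0; 0, 1, 0]

/-- A sequence of control inputs over the horizon. -/
abbrev Params.Inputs (P : Params) := Fin P.Np → ℝ

/-- The state `x(k|t)`, `k = 0, …, N_p`, predicted from the current state `x` and the inputs `u`
by `x(0|t) = x`, `x(k+1|t) = φ(x(k|t)) + u(k|t) ψ` (constant for `k ≥ N_p`). -/
def VehicleParams.predState (c : VehicleParams) (P : Params) (x : State) (u : P.Inputs) :
    ℕ → State
  | 0 => x
  | k + 1 =>
    if hk : k < P.Np then
      c.phi P (c.predState P x u k) + u ⟨k, hk⟩ • c.psi P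
    else c.predState P x u k

/-- The predicted output `y(k|t) = γ x(k|t)`. -/
def VehicleParams.predOutput (c : VehicleParams) (P : Params) (x : State) (u : P.Inputs)
    (k : ℕ) : Output :=
  gam *ᵥ c.predState P x u k

/-- The assumed inputs for the next time step: the inputs `u`, shifted by one step and completed
by the equilibrium input at the terminal predicted velocity. -/
def VehicleParams.shiftInput (c : VehicleParams) (P : Params) (x : State) (u : P.Inputs) :
    P.Inputs := fun k =>
  if hk : (k : ℕ) + 1 < P.Np then u ⟨k + 1, hk⟩ else c.drag P (c.predState P x u P.Np 1)

/-- The assumed output `y^a(k|t+1)`: the output predicted from `x(1|t)` with the assumed inputs. -/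
def VehicleParams.shiftOutput (c : VehicleParams) (P : Params) (x : State) (u : P.Inputs)
    (k : ℕ) : Output :=
  c.predOutput P (c.predState P x u 1) (c.shiftInput P x u) k

/-- The followers that ever take part: `N` initial ones and `Nci` that cut in. -/
abbrev Vehicle (N Nci : ℕ) := Fin N ⊕ Fin Nci

/-- A dynamic platoon with `N` initial followers, `Nci` cut-ins (at the times `tci`) and `Nco`
cut-outs (of the vehicles `co` at the times `tco`).  `rank` is the order along the road of all the
followers that ever take part (smaller means closer to the leader): a cut-in may take place at
any position, and the other vehicles keep their relative order.  `adj t i j` means `a_ij = 1`,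
that is, `j` sends information to `i` at time `t`; `pinned t i` means `p_i = 1`.
Communication is unidirectional: information flows from front to back. -/
structure Scenario (N Nci Nco : ℕ) where
  veh : Vehicle N Nci → VehicleParams
  rank : Vehicle N Nci → ℕ
  rank_injective : Function.Injective rank
  tci : Fin Nci → ℕ
  tco : Fin Nco → ℕ
  co : Fin Nco → Vehicle N Nci
  co_injective : Function.Injective co
  tci_le_tco : ∀ i j, co j = Sum.inr i → tci i ≤ tco j
  adj : ℕ → Vehicle N Nci → Vehicle N Nci → Prop
  pinned : ℕ → Vehicle N Nci → Prop
  unidirectional : ∀ t i j, adj t i j → rank j < rank i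

variable {N Nci Nco : ℕ}

namespace Scenario

/-- The time at which a vehicle joins the platoon (`0` for the initial followers). -/
def joinTime (S : Scenario N Nci Nco) : Vehicle N Nci → ℕ := Sum.elim (fun _ => 0) S.tci

open Classical in
/-- The followers in the platoon at time `t`. -/
def members (S : Scenario N Nci Nco) (t : ℕ) : Finset (Vehicle N Nci) :=
  Finset.univ.filter fun i => S.joinTime i ≤ t ∧ ¬ ∃ j, S.co j = i ∧ S.tco j ≤ t

open Classical in
/-- The index in `{1, …, n}` of a follower in the platoon of time `t`. -/
def idx (S : Scenario N Nci Nco) (t : ℕ) (i : Vehicle N Nci) : ℕ :=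
  ((S.members t).filter fun j => S.rank j ≤ S.rank i).card

open Classical in
/-- `ℕ_i`: the followers from which `i` gets information. -/
def inNbrs (S : Scenario N Nci Nco) (t : ℕ) (i : Vehicle N Nci) : Finset (Vehicle N Nci) :=
  (S.members t).filter fun j => S.adj t i j

open Classical in
/-- `𝕆_i`: the followers to which `i` sends information. -/
def outNbrs (S : Scenario N Nci Nco) (t : ℕ) (i : Vehicle N Nci) : Finset (Vehicle N Nci) :=
  (S.members t).filter fun j => S.adj t j i

open Classical in
/-- `𝕀_i = ℕ_i ∪ ℙ_i`: all vehicles from which `i` gets information; `none` is the leader. -/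
def sources (S : Scenario N Nci Nco) (t : ℕ) (i : Vehicle N Nci) :
    Finset (Option (Vehicle N Nci)) :=
  (S.inNbrs t i).map Function.Embedding.some ∪ (if S.pinned t i then {none} else ∅)

/-- The directed graph of the platoon at time `t` on the leader `none` and the followers;
`Edge t a b` means that `a` sends information to `b`. -/
def Edge (S : Scenario N Nci Nco) (t : ℕ) (a b : Option (Vehicle N Nci)) : Prop :=
  ∃ i ∈ S.members t, b = some i ∧ a ∈ S.sources t i

/-- The graph of the platoon at time `t` contains a spanning tree rooted at the leader: a
subgraph `E` in which each follower has exactly one incoming edge and is reached from the leader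
by a directed path (the leader has no incoming edge in the graph). -/
def HasSpanningTree (S : Scenario N Nci Nco) (t : ℕ) : Prop :=
  ∃ E : Option (Vehicle N Nci) → Option (Vehicle N Nci) → Prop,
    (∀ a b, E a b → S.Edge t a b) ∧
    (∀ i ∈ S.members t, ∃! a, E a (some i)) ∧
    (∀ i ∈ S.members t, Relation.ReflTransGen E none (some i))

/-- The convergence time: the time of the last maneuver (`0` if there is none) plus
`N + Nci - Nco`. -/
def tconv (S : Scenario N Nci Nco) : ℕ :=
  max (Finset.univ.sup S.tci) (Finset.univ.sup S.tco) + (N + Nci - Nco)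

/-- The output `y_0(k|t)` of the leader, `k` steps after time `t`. -/
def leaderOutput (P : Params) (t k : ℕ) : Output :=
  ![P.s0 + ((t : ℝ) + k) * P.v0 * P.dt, P.v0]

/-- The desired output `y_des,i(k|t)`. -/
def desOutput (S : Scenario N Nci Nco) (P : Params) (t : ℕ) (i : Vehicle N Nci) (k : ℕ) : Output :=
  leaderOutput P t k - ![(S.idx t i : ℝ) * P.gap, 0]

/-- The desired displacement of `i` relative to `j` (`j = none` is the leader, with index `0`). -/
def disp (S : Scenario N Nci Nco) (P : Params) (t : ℕ) (i : Vehicle N Nci)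
    (j : Option (Vehicle N Nci)) : Output :=
  ![((j.elim 0 (S.idx t) : ℕ) : ℝ) * P.gap - (S.idx t i : ℝ) * P.gap, 0]

/-- The assumed output of a source of information: the leader has its true future output. -/
def srcOutput (P : Params) (t : ℕ) (ya : Vehicle N Nci → ℕ → Output)
    (j : Option (Vehicle N Nci)) (k : ℕ) : Output :=
  j.elim (leaderOutput P t k) (fun j => ya j k)

end Scenario

/-- `‖x‖_A = xᵀ A x`. -/
def wnorm {n : ℕ} (A : Matrix (Fin n) (Fin n) ℝ) (x : Fin n → ℝ) : ℝ := x ⬝ᵥ (A *ᵥ x)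

/-- The squared Frobenius norm `tr(Aᵀ A)`. -/
def frobSq (A : Mat2) : ℝ := (Aᵀ * A).trace

/-- `A ⪰_ε 0`: symmetric with all eigenvalues at least `ε`. -/
def EpsPosDef (e : ℝ) (A : Mat2) : Prop := (A - e • (1 : Mat2)).PosSemidef

/-- The weights of the four terms of the cost. -/
structure Weights where
  Q : Mat2
  R : ℝ
  F : Mat2
  G : Mat2

def Weights.Nonneg (W : Weights) : Prop :=
  W.Q.PosSemidef ∧ 0 ≤ W.R ∧ W.F.PosSemidef ∧ W.G.PosSemidef

/-- The decision variables of the metric-learning problem of one follower. -/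
structure MLVars (P : Params) where
  U : P.Inputs
  W : Weights
  Th : Mat2

/-- The variables of ADMM for one follower: those of the metric-learning problem and the scaled
dual variable `Ω`. -/
structure ADMMVars (P : Params) extends MLVars P where
  Om : Mat2

namespace Scenario

/-- The cost `J_i` at time `t`, where `x` is the current state of `i` and `ya` gives the assumed
outputs. -/
def cost (S : Scenario N Nci Nco) (P : Params) (t : ℕ) (x : Vehicle N Nci → State)
    (ya : Vehicle N Nci → ℕ → Output) (i : Vehicle N Nci) (u : P.Inputs) (W : Weights) : ℝ :=
  ∑ k : Fin P.Np,
    (wnorm W.Q ((S.veh i).predOutput P (x i) u k - S.desOutput P t i k)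
      + W.R * (u k - (S.veh i).drag P ((S.veh i).predState P (x i) u k 1)) ^ 2
      + wnorm W.F ((S.veh i).predOutput P (x i) u k - ya i k)
      + ∑ j ∈ S.inNbrs t i,
          wnorm W.G ((S.veh i).predOutput P (x i) u k - ya j k - S.disp P t i (some j)))

/-- The constraints of the DNMPC problem of follower `i` at time `t` (dynamics, output equation and
initial state are built into `predState` and `predOutput`): bounds of the inputs, terminal
output equal to the average of the shifted assumed terminal outputs, terminal torque. -/
structure Feasible (S : Scenario N Nci Nco) (P : Params) (t : ℕ) (x : Vehicle N Nci → State)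
    (ya : Vehicle N Nci → ℕ → Output) (i : Vehicle N Nci) (u : P.Inputs) : Prop where
  bounds : ∀ k, u k ∈ Set.Icc (S.veh i).umin (S.veh i).umax
  terminal_output : (S.veh i).predOutput P (x i) u P.Np =
    (1 / ((S.sources t i).card : ℝ)) •
      ∑ j ∈ S.sources t i, (srcOutput P t ya j P.Np + S.disp P t i j)
  terminal_torque : (S.veh i).predState P (x i) u P.Np 2 =
    (S.veh i).drag P ((S.veh i).predState P (x i) u P.Np 1)

/-- `u` solves the DNMPC problem of follower `i` at time `t` with the weights `W`. -/
def IsDNMPCSolution (S : Scenario N Nci Nco) (P : Params) (t : ℕ) (x : Vehicle N Nci → State)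
    (ya : Vehicle N Nci → ℕ → Output) (i : Vehicle N Nci) (W : Weights) (u : P.Inputs) : Prop :=
  S.Feasible P t x ya i u ∧
    ∀ u', S.Feasible P t x ya i u' → S.cost P t x ya i u W ≤ S.cost P t x ya i u' W

/-- The constraint on `G_i`. -/
def GConstraint (S : Scenario N Nci Nco) (P : Params) (t : ℕ) (i : Vehicle N Nci) (G : Mat2) :
    Prop :=
  ((S.inNbrs t i).Nonempty → EpsPosDef P.eps G) ∧ (S.inNbrs t i = ∅ → G = 0)

/-- The constraint on `F_i`, given the matrices `G_j` of the other followers. -/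
def FConstraint (S : Scenario N Nci Nco) (P : Params) (t : ℕ) (i : Vehicle N Nci)
    (Gs : Vehicle N Nci → Mat2) (F : Mat2) : Prop :=
  (S.outNbrs t i = ∅ → EpsPosDef P.eps F) ∧
  ((S.outNbrs t i).Nonempty → (F - ∑ j ∈ S.outNbrs t i, Gs j).PosSemidef)

/-- The constraints of the metric-learning problem of follower `i`, given the matrices `G_j` of
the others.  For an unpinned follower `Q_i = 0`; for a pinned one `Q_i = Θ_i ⪰_ε 0`. -/
structure MLFeasible (S : Scenario N Nci Nco) (P : Params) (t : ℕ) (x : Vehicle N Nci → State)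
    (ya : Vehicle N Nci → ℕ → Output) (i : Vehicle N Nci) (Gs : Vehicle N Nci → Mat2)
    (D : MLVars P) : Prop where
  dnmpc : S.Feasible P t x ya i D.U
  theta : EpsPosDef P.eps D.Th
  unpinned : ¬ S.pinned t i → D.W.Q = 0
  pinned : S.pinned t i → D.W.Q - D.Th = 0
  R_ge : P.eps ≤ D.W.R
  G_mem : S.GConstraint P t i D.W.G
  F_mem : S.FConstraint P t i Gs D.W.F

/-- `D` solves the metric-learning problems of all followers at time `t`. -/
def IsMLSolution (S : Scenario N Nci Nco) (P : Params) (t : ℕ) (x : Vehicle N Nci → State)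
    (ya : Vehicle N Nci → ℕ → Output) (D : Vehicle N Nci → MLVars P) : Prop :=
  ∀ i ∈ S.members t,
    S.MLFeasible P t x ya i (fun j => (D j).W.G) (D i) ∧
    ∀ D', S.MLFeasible P t x ya i (fun j => (D j).W.G) D' →
      S.cost P t x ya i (D i).U (D i).W ≤ S.cost P t x ya i D'.U D'.W

/-- One round of ADMM updates at time `t`, from the variables `a` to the variables `b` of all
followers; the variables are updated in the order `U, Q, Θ, Ω, R, G, F`. -/
structure ADMMStep (S : Scenario N Nci Nco) (P : Params) (t : ℕ) (x : Vehicle N Nci → State)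
    (ya : Vehicle N Nci → ℕ → Output) (a b : Vehicle N Nci → ADMMVars P) : Prop where
  U_update : ∀ i ∈ S.members t, S.IsDNMPCSolution P t x ya i (a i).W (b i).U
  Q_update_unpinned : ∀ i ∈ S.members t, ¬ S.pinned t i → (b i).W.Q = 0
  Q_update : ∀ i ∈ S.members t, S.pinned t i →
    IsMinOn (fun Q => S.cost P t x ya i (b i).U { (a i).W with Q := Q }
      + P.rho / 2 * frobSq (Q - (a i).Th + (a i).Om)) Set.univ (b i).W.Q
  Th_mem : ∀ i ∈ S.members t, EpsPosDef P.eps (b i).Th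
  Th_update : ∀ i ∈ S.members t,
    IsMinOn (fun Th => P.rho / 2 * frobSq ((b i).W.Q - Th + (a i).Om))
      {Th | EpsPosDef P.eps Th} (b i).Th
  Om_update : ∀ i ∈ S.members t, (b i).Om = (a i).Om + (b i).W.Q - (b i).Th
  R_mem : ∀ i ∈ S.members t, P.eps ≤ (b i).W.R
  R_update : ∀ i ∈ S.members t,
    IsMinOn (fun R => S.cost P t x ya i (b i).U { (a i).W with Q := (b i).W.Q, R := R })
      {R | P.eps ≤ R} (b i).W.R
  G_mem : ∀ i ∈ S.members t, S.GConstraint P t i (b i).W.G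
  G_update : ∀ i ∈ S.members t,
    IsMinOn (fun G => S.cost P t x ya i (b i).U
      { (a i).W with Q := (b i).W.Q, R := (b i).W.R, G := G })
      {G | S.GConstraint P t i G} (b i).W.G
  F_mem : ∀ i ∈ S.members t, S.FConstraint P t i (fun j => (b j).W.G) (b i).W.F
  F_update : ∀ i ∈ S.members t,
    IsMinOn (fun F => S.cost P t x ya i (b i).U { (b i).W with F := F })
      {F | S.FConstraint P t i (fun j => (b j).W.G) F} (b i).W.F

/-- The inputs `u` at time `t` are obtained from the metric-learning problem by ADMM: for some
infinite run of ADMM (from any initial values), the inputs of each follower are an iterate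
(after at least one round), or a limit point of the iterates. -/
def IsADMMOutput (S : Scenario N Nci Nco) (P : Params) (t : ℕ) (x : Vehicle N Nci → State)
    (ya : Vehicle N Nci → ℕ → Output) (u : Vehicle N Nci → P.Inputs) : Prop :=
  ∃ run : ℕ → Vehicle N Nci → ADMMVars P,
    (∀ n, S.ADMMStep P t x ya (run n) (run (n + 1))) ∧
    ∀ i ∈ S.members t,
      (∃ n, 1 ≤ n ∧ u i = (run n i).U) ∨
        MapClusterPt (u i) Filter.atTop (fun n => (run n i).U)

/-- The inputs `u` at time `t` belong to an exact solution of the metric-learning problem. -/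
def IsExactMLOutput (S : Scenario N Nci Nco) (P : Params) (t : ℕ) (x : Vehicle N Nci → State)
    (ya : Vehicle N Nci → ℕ → Output) (u : Vehicle N Nci → P.Inputs) : Prop :=
  ∃ D, S.IsMLSolution P t x ya D ∧ ∀ i ∈ S.members t, u i = (D i).U

end Scenario

/-- The signals of a platoon run by model predictive control: `x t i` is the state of follower `i`
at time `t`, `u t i` the sequence of inputs computed at time `t`, and `ya t i k` the assumed
output `y_i^a(k|t)`. -/
structure Signals (P : Params) (N Nci : ℕ) where
  x : ℕ → Vehicle N Nci → State
  u : ℕ → Vehicle N Nci → P.Inputs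
  ya : ℕ → Vehicle N Nci → ℕ → Output

/-- The receding-horizon loop: the first input is applied, and the assumed outputs of the next
step are obtained by shifting.  When a vehicle joins the platoon, its state and its assumed
outputs are arbitrary. -/
structure Signals.IsClosedLoop {P : Params} (Z : Signals P N Nci) (S : Scenario N Nci Nco) :
    Prop where
  state : ∀ t, ∀ i ∈ S.members t,
    Z.x (t + 1) i = (S.veh i).phi P (Z.x t i) + Z.u t i ⟨0, P.Np_pos⟩ • (S.veh i).psi P
  assumed : ∀ t, ∀ i ∈ S.members t, i ∈ S.members (t + 1) → ∀ k ≤ P.Np,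
    Z.ya (t + 1) i k = (S.veh i).shiftOutput P (Z.x t i) (Z.u t i) k

/-- The terminal predicted output `y_i^p(N_p|t)`. -/
def Signals.terminalOutput {P : Params} (Z : Signals P N Nci) (S : Scenario N Nci Nco) (t : ℕ)
    (i : Vehicle N Nci) : Output :=
  (S.veh i).predOutput P (Z.x t i) (Z.u t i) P.Np

end

end Platoon

/-! The weights and the cost affect only the choice among feasible inputs; the claim holds for every
closed loop whose inputs are feasible for the DNMPC problem. An exact solution is feasible, and so
is each ADMM iterate after one round, since it solves a DNMPC problem; limit points are feasible
because the feasible set is closed (`isClosed_setOf_feasible`).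

The terminal torque balances the resistance, so the assumed terminal output of the next time step is
the present terminal output advanced by `dt` at constant velocity (`shiftOutput_Np`). The desired
output moves in the same way (`desOutput_succ`). Once all sources of a follower have settled, its
terminal constraint averages copies of its own desired output (`Feasible.predOutput_eq_desOutput`).
Followers listen only to vehicles ahead, so correctness travels backwards by at least one index per
time step, and the index is at most the final platoon size. The common value `desOutput` depends on
neither weights nor initial data, which gives the second claim. -/

namespace Platoon

open scoped Matrix

/-! ### Predictions -/

namespace VehicleParams

variable (c : VehicleParams) (P : Params)

theorem predState_succ (x : State) (u : P.Inputs) {k : ℕ} (hk : k < P.Np) :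
    c.predState P x u (k + 1) = c.phi P (c.predState P x u k) + u ⟨k, hk⟩ • c.psi P := by
  simp [predState, hk]

theorem continuous_phi : Continuous (c.phi P) := by
  unfold phi resist
  refine continuous_pi fun l => ?_
  fin_cases l <;> simp <;> fun_prop

theorem continuous_predState (x : State) (k : ℕ) :
    Continuous fun u : P.Inputs => c.predState P x u k := by
  induction k with
  | zero => exact continuous_const
  | succ k ih =>
    by_cases hk : k < P.Np
    · simp only [c.predState_succ P x _ hk]
      exact ((c.continuous_phi P).comp ih).add ((continuous_apply _).smul continuous_const)
    · simpa [predState, hk] using ih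

theorem continuous_drag : Continuous (c.drag P) := by
  unfold drag resist
  fun_prop

theorem continuous_predOutput (x : State) (k : ℕ) :
    Continuous fun u : P.Inputs => c.predOutput P x u k :=
  continuous_const.matrix_mulVec (c.continuous_predState P x k)

theorem predOutput_eq (x : State) (u : P.Inputs) (k : ℕ) :
    c.predOutput P x u k = ![c.predState P x u k 0, c.predState P x u k 1] := by
  ext l
  fin_cases l <;> simp [predOutput, gam, Matrix.mulVec, dotProduct, Fin.sum_univ_three]

/-- The prediction from the next state with the shifted inputs follows the current one. -/
theorem predState_shiftInput (x : State) (u : P.Inputs) {k : ℕ} (hk : k < P.Np) :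
    c.predState P (c.predState P x u 1) (c.shiftInput P x u) k = c.predState P x u (k + 1) := by
  induction k with
  | zero => rfl
  | succ k ih =>
    rw [c.predState_succ P _ _ (by omega : k < P.Np), ih (by omega), c.predState_succ P x u hk]
    simp [shiftInput, hk]

/-- If the terminal torque is the drag at the terminal velocity, the assumed trajectory extends
the predicted one at constant velocity. -/
theorem shiftOutput_Np (x : State) (u : P.Inputs)
    (hT : c.predState P x u P.Np 2 = c.drag P (c.predState P x u P.Np 1)) :
    c.shiftOutput P x u P.Np =
      ![c.predOutput P x u P.Np 0 + c.predOutput P x u P.Np 1 * P.dt,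
        c.predOutput P x u P.Np 1] := by
  obtain ⟨n, hn⟩ : ∃ n, P.Np = n + 1 := ⟨P.Np - 1, by have := P.Np_pos; omega⟩
  have hlt : n < P.Np := by omega
  have key : c.predState P (c.predState P x u 1) (c.shiftInput P x u) P.Np =
      c.phi P (c.predState P x u P.Np) + c.shiftInput P x u ⟨n, hlt⟩ • c.psi P := by
    conv_lhs => rw [hn]
    rw [c.predState_succ P _ _ hlt, c.predState_shiftInput P x u hlt, ← hn]
  rw [shiftOutput, predOutput_eq, predOutput_eq, key]
  have hr := c.r_pos.ne'
  have he := c.eta_pos.ne'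
  -- The driving force at the terminal state cancels the resistance, so the velocity does not change
  -- in the added step.
  have hv : c.eta / c.r * c.predState P x u P.Np 2 = c.resist P (c.predState P x u P.Np 1) := by
    rw [hT, drag]
    field_simp
  ext l
  -- `psi` acts on the torque alone, so the appended input cannot affect the output at this last
  -- step.
  fin_cases l
  · simp [phi, psi]
  · simp [phi, psi, hv]

end VehicleParams

namespace Scenario

variable {N Nci Nco : ℕ} (S : Scenario N Nci Nco)

/-! ### Feasibility of the inputs -/

/-- Predicted states depend continuously on the inputs, and the constraints are closed intervals and
equations between continuous functions. -/
theorem isClosed_setOf_feasible (P : Params) (t : ℕ) (x : Vehicle N Nci → State)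
    (ya : Vehicle N Nci → ℕ → Output) (i : Vehicle N Nci) :
    IsClosed {u | S.Feasible P t x ya i u} := by
  have hset : {u | S.Feasible P t x ya i u} =
      {u | ∀ k, u k ∈ Set.Icc (S.veh i).umin (S.veh i).umax} ∩
      ({u | (S.veh i).predOutput P (x i) u P.Np = (1 / ((S.sources t i).card : ℝ)) •
        ∑ j ∈ S.sources t i, (srcOutput P t ya j P.Np + S.disp P t i j)} ∩
      {u | (S.veh i).predState P (x i) u P.Np 2 =
        (S.veh i).drag P ((S.veh i).predState P (x i) u P.Np 1)}) :=
    Set.ext fun u => ⟨fun h => ⟨h.bounds, h.terminal_output, h.terminal_torque⟩,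
      fun h => ⟨h.1, h.2.1, h.2.2⟩⟩
  have hs := (S.veh i).continuous_predState P (x i) P.Np
  rw [hset]
  refine IsClosed.inter ?_ (IsClosed.inter ?_ ?_)
  · rw [Set.ofPred_forall]
    exact isClosed_iInter fun k => isClosed_Icc.preimage (continuous_apply k)
  · exact isClosed_eq ((S.veh i).continuous_predOutput P (x i) P.Np) continuous_const
  · exact isClosed_eq ((continuous_apply 2).comp hs)
      (((S.veh i).continuous_drag P).comp ((continuous_apply 1).comp hs))

variable {S} in
theorem IsADMMOutput.feasible {P : Params} {t : ℕ} {x : Vehicle N Nci → State}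
    {ya : Vehicle N Nci → ℕ → Output} {u : Vehicle N Nci → P.Inputs}
    (h : S.IsADMMOutput P t x ya u) {i : Vehicle N Nci} (hi : i ∈ S.members t) :
    S.Feasible P t x ya i (u i) := by
  obtain ⟨run, hstep, hout⟩ := h
  -- The initial value `run 0` is arbitrary and may be infeasible; each later iterate comes from a
  -- `U_update`.
  have hrun : ∀ n, 1 ≤ n → S.Feasible P t x ya i (run n i).U := by
    intro n hn
    obtain ⟨m, rfl⟩ := Nat.exists_eq_add_of_le' hn
    exact ((hstep m).U_update i hi).1
  rcases hout i hi with ⟨n, hn, hu⟩ | hu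
  · exact hu ▸ hrun n hn
  · refine (S.isClosed_setOf_feasible P t x ya i).mem_of_mapClusterPt hu ?_
    filter_upwards [Filter.eventually_ge_atTop 1] with n hn using hrun n hn

variable {S} in
theorem IsExactMLOutput.feasible {P : Params} {t : ℕ} {x : Vehicle N Nci → State}
    {ya : Vehicle N Nci → ℕ → Output} {u : Vehicle N Nci → P.Inputs}
    (h : S.IsExactMLOutput P t x ya u) {i : Vehicle N Nci} (hi : i ∈ S.members t) :
    S.Feasible P t x ya i (u i) := by
  obtain ⟨D, hD, hu⟩ := h
  exact hu i hi ▸ (hD i hi).1.dnmpc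

/-! ### The platoon after the last maneuver -/

/-- The time of the last maneuver. -/
def lastManeuver : ℕ := max (Finset.univ.sup S.tci) (Finset.univ.sup S.tco)

/-- By then every cut-in has joined and every cut-out has left, so membership no longer depends on
time. -/
theorem mem_members_iff_of_lastManeuver_le {t : ℕ} (ht : S.lastManeuver ≤ t)
    (i : Vehicle N Nci) : i ∈ S.members t ↔ i ∉ Set.range S.co := by
  have hci : ∀ j, S.tci j ≤ t := fun j =>
    (Finset.le_sup (Finset.mem_univ j)).trans ((le_max_left _ _).trans ht)
  have hco : ∀ j, S.tco j ≤ t := fun j =>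
    (Finset.le_sup (Finset.mem_univ j)).trans ((le_max_right _ _).trans ht)
  have hjoin : S.joinTime i ≤ t := by
    cases i with
    | inl i => exact Nat.zero_le t
    | inr i => exact hci i
  simp [members, hjoin, hco]

theorem members_eq_of_lastManeuver_le {s t : ℕ} (hs : S.lastManeuver ≤ s)
    (ht : S.lastManeuver ≤ t) : S.members s = S.members t := by
  ext i
  rw [S.mem_members_iff_of_lastManeuver_le hs, S.mem_members_iff_of_lastManeuver_le ht]

theorem idx_eq_of_lastManeuver_le {s t : ℕ} (hs : S.lastManeuver ≤ s)
    (ht : S.lastManeuver ≤ t) (i : Vehicle N Nci) : S.idx s i = S.idx t i := by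
  rw [idx, idx, S.members_eq_of_lastManeuver_le hs ht]

theorem card_members_of_lastManeuver_le {t : ℕ} (ht : S.lastManeuver ≤ t) :
    (S.members t).card = N + Nci - Nco := by
  classical
  have hmem : S.members t = (Finset.univ.image S.co)ᶜ := by
    ext i
    simp [S.mem_members_iff_of_lastManeuver_le ht]
  rw [hmem, Finset.card_compl, Finset.card_image_of_injective _ S.co_injective]
  simp

/-- An index counts a subset of the members, hence is at most the final platoon size; this is the
second summand of `tconv`. -/
theorem lastManeuver_add_idx_le_tconv {t : ℕ} (ht : S.lastManeuver ≤ t) (i : Vehicle N Nci) :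
    S.lastManeuver + S.idx t i ≤ S.tconv := by
  refine Nat.add_le_add_left ?_ _
  rw [← S.card_members_of_lastManeuver_le ht]
  exact Finset.card_filter_le _ _

theorem mem_inNbrs {t : ℕ} {i j : Vehicle N Nci} :
    j ∈ S.inNbrs t i ↔ j ∈ S.members t ∧ S.adj t i j := by
  simp [inNbrs]

theorem idx_lt_of_mem_inNbrs {t : ℕ} {i j : Vehicle N Nci} (hi : i ∈ S.members t)
    (hj : j ∈ S.inNbrs t i) : S.idx t j < S.idx t i := by
  have hr : S.rank j < S.rank i := S.unidirectional t i j (S.mem_inNbrs.1 hj).2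
  -- Every vehicle counted for `j` is counted for `i`, and `i` itself is counted only for `i`.
  refine Finset.card_lt_card (Finset.ssubset_iff_of_subset ?_ |>.2 ⟨i, ?_, ?_⟩)
  · intro l hl
    rw [Finset.mem_filter] at hl ⊢
    exact ⟨hl.1, hl.2.trans hr.le⟩
  · simp [hi]
  · simp [hr]

theorem idx_pos {t : ℕ} {i : Vehicle N Nci} (hi : i ∈ S.members t) : 0 < S.idx t i :=
  Finset.card_pos.2 ⟨i, by simp [hi]⟩

theorem some_mem_sources {t : ℕ} {i j : Vehicle N Nci} (h : some j ∈ S.sources t i) :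
    j ∈ S.inNbrs t i := by
  unfold sources at h
  split_ifs at h <;> simpa using h

variable {S} in
-- This makes the average in the terminal constraint a genuine one: with no sources, `1 / 0 = 0`
-- would force the terminal output to be zero.
theorem HasSpanningTree.sources_nonempty {t : ℕ} (h : S.HasSpanningTree t) {i : Vehicle N Nci}
    (hi : i ∈ S.members t) : (S.sources t i).Nonempty := by
  obtain ⟨E, hE, hin, -⟩ := h
  obtain ⟨a, ha, -⟩ := hin i hi
  obtain ⟨l, -, hl, hmem⟩ := hE _ _ ha
  obtain rfl : i = l := Option.some.inj hl
  exact ⟨a, hmem⟩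

/-! ### Propagation of the desired terminal output -/

theorem leaderOutput_add_disp_none (P : Params) (t k : ℕ) (i : Vehicle N Nci) :
    leaderOutput P t k + S.disp P t i none = S.desOutput P t i k := by
  ext l
  fin_cases l <;> simp [disp, desOutput, leaderOutput]
  ring

theorem desOutput_add_disp_some (P : Params) (t k : ℕ) (i j : Vehicle N Nci) :
    S.desOutput P t j k + S.disp P t i (some j) = S.desOutput P t i k := by
  ext l
  fin_cases l <;> simp [disp, desOutput, leaderOutput]

/-- The right-hand side has the form found in `shiftOutput_Np`. A change of index would add a jump
by a multiple of the gap. -/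
theorem desOutput_succ (P : Params) {t : ℕ} {i : Vehicle N Nci}
    (hidx : S.idx (t + 1) i = S.idx t i) (k : ℕ) :
    S.desOutput P (t + 1) i k =
      ![S.desOutput P t i k 0 + S.desOutput P t i k 1 * P.dt, S.desOutput P t i k 1] := by
  ext l
  fin_cases l <;> simp [desOutput, leaderOutput, hidx]
  ring

variable {S} in
/-- If all the followers in `ℕ_i` have the desired assumed terminal output, then `i` has the
desired predicted terminal output. -/
theorem Feasible.predOutput_eq_desOutput {P : Params} {t : ℕ} {x : Vehicle N Nci → State}
    {ya : Vehicle N Nci → ℕ → Output} {i : Vehicle N Nci} {u : P.Inputs}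
    (h : S.Feasible P t x ya i u) (hne : (S.sources t i).Nonempty)
    (hya : ∀ j ∈ S.inNbrs t i, ya j P.Np = S.desOutput P t j P.Np) :
    (S.veh i).predOutput P (x i) u P.Np = S.desOutput P t i P.Np := by
  have hsum : ∀ j ∈ S.sources t i,
      srcOutput P t ya j P.Np + S.disp P t i j = S.desOutput P t i P.Np := by
    rintro (_ | j) hj
    · exact S.leaderOutput_add_disp_none P t P.Np i
    · change ya j P.Np + _ = _
      rw [hya j (S.some_mem_sources hj), desOutput_add_disp_some]
  have hcard : ((S.sources t i).card : ℝ) ≠ 0 := by exact_mod_cast hne.card_pos.ne'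
  rw [h.terminal_output, Finset.sum_congr rfl hsum, Finset.sum_const, ← Nat.cast_smul_eq_nsmul ℝ,
    smul_smul, one_div, inv_mul_cancel₀ hcard, one_smul]

/-- In a closed loop with feasible inputs, the follower of index `n` has the desired terminal
output from `n` steps after the last maneuver on. -/
theorem terminalOutput_eq_of_lastManeuver_add_idx_le {P : Params}
    (hTree : ∀ t, S.HasSpanningTree t) {Z : Signals P N Nci} (hZ : Z.IsClosedLoop S)
    (hF : ∀ t, ∀ i ∈ S.members t, S.Feasible P t (Z.x t) (Z.ya t) i (Z.u t i))
    {t : ℕ} {i : Vehicle N Nci} (hi : i ∈ S.members t) (ht : S.lastManeuver + S.idx t i ≤ t) :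
    Z.terminalOutput S t i = S.desOutput P t i P.Np := by
  induction t generalizing i with
  -- Indices start at 1, so the time bound excludes `t = 0`.
  | zero => have := S.idx_pos hi; omega
  | succ t ih =>
    refine (hF _ i hi).predOutput_eq_desOutput ((hTree _).sources_nonempty hi) fun j hj => ?_
    have hlt := S.idx_lt_of_mem_inNbrs hi hj
    -- The index of `i` exceeds that of `j`, so it is at least 1 and absorbs the step from `t + 1`
    -- back to `t`.
    have hs : S.lastManeuver ≤ t := by omega
    have hjm : j ∈ S.members (t + 1) := (S.mem_inNbrs.1 hj).1
    have hidx : S.idx (t + 1) j = S.idx t j :=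
      S.idx_eq_of_lastManeuver_le (hs.trans t.le_succ) hs j
    have hjm' : j ∈ S.members t := by
      rwa [S.members_eq_of_lastManeuver_le hs (hs.trans t.le_succ)]
    have hdes : (S.veh j).predOutput P (Z.x t j) (Z.u t j) P.Np = S.desOutput P t j P.Np :=
      ih hjm' (by omega)
    -- Since `j` was already present at time `t`, its assumed output is a shifted prediction and not
    -- an arbitrary joining value.
    rw [hZ.assumed t j hjm' hjm P.Np le_rfl,
      (S.veh j).shiftOutput_Np P _ _ (hF t j hjm').terminal_torque, hdes,
      S.desOutput_succ P hidx]

theorem terminalOutput_eq_of_tconv_le {P : Params}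
    (hTree : ∀ t, S.HasSpanningTree t) {Z : Signals P N Nci} (hZ : Z.IsClosedLoop S)
    (hF : ∀ t, ∀ i ∈ S.members t, S.Feasible P t (Z.x t) (Z.ya t) i (Z.u t i))
    {t : ℕ} (ht : S.tconv ≤ t) {i : Vehicle N Nci} (hi : i ∈ S.members t) :
    Z.terminalOutput S t i = S.desOutput P t i P.Np :=
  S.terminalOutput_eq_of_lastManeuver_add_idx_le hTree hZ hF hi
    ((S.lastManeuver_add_idx_le_tconv ((Nat.le_add_right _ _).trans ht) i).trans ht)

end Scenario

end Platoon

theorem theorem4 {N Nci Nco : ℕ} (P : Platoon.Params) (S : Platoon.Scenario N Nci Nco)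
    (hTree : ∀ t, S.HasSpanningTree t)
    (Z : Platoon.Signals P N Nci) (hZ : Z.IsClosedLoop S)
    (hML : ∀ t, S.IsADMMOutput P t (Z.x t) (Z.ya t) (Z.u t) ∨
      S.IsExactMLOutput P t (Z.x t) (Z.ya t) (Z.u t)) :
    (∀ t, S.tconv ≤ t → ∀ i ∈ S.members t,
      Z.terminalOutput S t i = S.desOutput P t i P.Np) ∧
    (∀ (W : ℕ → Platoon.Vehicle N Nci → Platoon.Weights) (Z' : Platoon.Signals P N Nci),
      (∀ t i, (W t i).Nonneg) → Z'.IsClosedLoop S →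
      (∀ t, ∀ i ∈ S.members t,
        S.IsDNMPCSolution P t (Z'.x t) (Z'.ya t) i (W t i) (Z'.u t i)) →
      ∀ t, S.tconv ≤ t → ∀ i ∈ S.members t,
        Z.terminalOutput S t i = Z'.terminalOutput S t i) := by
  have hF : ∀ t, ∀ i ∈ S.members t, S.Feasible P t (Z.x t) (Z.ya t) i (Z.u t i) :=
    fun t i hi => (hML t).elim (fun h => h.feasible hi) fun h => h.feasible hi
  refine ⟨fun t ht i hi => S.terminalOutput_eq_of_tconv_le hTree hZ hF ht hi, ?_⟩
  intro W Z' _ hZ' hsol t ht i hi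
  -- Both loops are feasible, so both terminal outputs equal the same `desOutput`.
  rw [S.terminalOutput_eq_of_tconv_le hTree hZ hF ht hi,
    S.terminalOutput_eq_of_tconv_le hTree hZ' (fun s j hj => (hsol s j hj).1) ht hi]
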